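/- Let $n\ge 2$ and $c\ge 1$. The universal virtual braid group $UV_n(c)$ is the group with generators $\sigma_{i,t},\rho_i$ ($1\le i\le n-1$, $1\le t\le c$) and relations $\rho_i\rho_{i+1}\rho_i=\rho_{i+1}\rho_i\rho_{i+1}$ and $\rho_i\rho_{i+1}\sigma_{i,t}=\sigma_{i+1,t}\rho_i\rho_{i+1}$ for $1\le i\le n-2$; $\rho_i^2=1$ for all $i$; and $\rho_i\rho_j=\rho_j\rho_i$, $\sigma_{i,t}\sigma_{j,\ell}=\sigma_{j,\ell}\sigma_{i,t}$, $\sigma_{i,t}\rho_j=\rho_j\sigma_{i,t}$ for $|i-j|\ge 2$ and all $1\le t,\ell\le c$. With $s_i=(i\ \,i+1)\in S_n$, let $PUV_n(c)$ be the kernel of the homomorphism $UV_n(c)\to S_n$ given by $\sigma_{i,t}\mapsto s_i$, $\rho_i\mapsto s_i$, and let $KUV_n(c)$ be the kernel of the one given by $\sigma_{i,t}\mapsto 1$, $\rho_i\mapsto s_i$. For $1\le i<j\le n$ and $w=\rho_{j-1}\rho_{j-2}\cdots\rho_{i+1}$ (so $w=1$ if $j=i+1$) put $\delta_{i,j,t}=w\,\sigma_{i,t}\,w^{-1}$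 and $\delta_{j,i,t}=w\,\rho_i\,\sigma_{i,t}\,\rho_i\,w^{-1}$. Let $\Gamma_{n,c}$ be the graph whose vertices are the triples $(i,j,t)$ with $1\le i\ne j\le n$ and $1\le t\le c$, where $(i,j,t)$ and $(k,\ell,m)$ are adjacent if and only if $i,j,k,\ell$ are pairwise distinct. A group is Howson if the intersection of any two of its finitely generated subgroups is finitely generated. Then: 1. $UV_n(c)$ is Howson if and only if $n\le 3$. 2. $PUV_n(c)$ is Howson if and only if $n\le 3$. 3. $\Gamma_{n,c}$ is the defining graph of $KUV_n(c)$: the assignment $(i,j,t)\mapsto\delta_{i,j,t}$ induces an isomorphism from the right-angled Artin group of $\Gamma_{n,c}$ (one generator for each vertex, with defining relations that adjacent vertices commute) onto $KUV_n(c)$. 4. If $n\ge 4$, then $\Gamma_{n,c}$ contains an induced path of length two, i.e. distinct vertices $v_1,v_2,v_3$ with $v_1,v_2$ adjacent, $v_2,v_3$ adjacent and $v_1,v_3$ not adjacent. For every such path, the subgroup of $UV_n(c)$ generated by $\delta_{v_1},\delta_{v_2},\delta_{v_3}$ is not Howson; and $KUV_n(c)$ is not Howson. -/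

import Mathlib

/-- A group has the Howson property if the intersection of any two finitely generated subgroups
is finitely generated. -/
def IsHowson (G : Type*) [Group G] : Prop :=
  ∀ A B : Subgroup G, A.FG → B.FG → (A ⊓ B).FG

/-! ### The universal virtual braid group

Strands are numbered `0, …, n - 1` and the generators `σ_{i,t}`, `ρ_i` are indexed by
`i = 0, …, n - 2` and `t = 0, …, c - 1`. -/

/-- The generators of `UV_n(c)`. -/
inductive UVGen (n c : ℕ) : Type
  | sigma (i : Fin (n - 1)) (t : Fin c) : UVGen n c
  | rho (i : Fin (n - 1)) : UVGen n c

namespace UVGen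

/-- The letter `σ_{i,t}` in the free group. -/
def S {n c : ℕ} (i : Fin (n - 1)) (t : Fin c) : FreeGroup (UVGen n c) := FreeGroup.of (sigma i t)

/-- The letter `ρ_i` in the free group. -/
def R {n : ℕ} (c : ℕ) (i : Fin (n - 1)) : FreeGroup (UVGen n c) := FreeGroup.of (rho i)

end UVGen

/-- `|i - j| ≥ 2`. -/
def FarApart {m : ℕ} (i j : Fin m) : Prop := i.val + 2 ≤ j.val ∨ j.val + 2 ≤ i.val

open UVGen in
/-- The defining relators of `UV_n(c)`: the relation `x = y` is encoded by the relator `x * y⁻¹`. -/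
inductive UVRel (n c : ℕ) : FreeGroup (UVGen n c) → Prop
  | pr1 (i j : Fin (n - 1)) (h : j.val = i.val + 1) :
      UVRel n c ((R c i * R c j * R c i) * (R c j * R c i * R c j)⁻¹)
  | pr2 (i j : Fin (n - 1)) (h : FarApart i j) :
      UVRel n c ((R c i * R c j) * (R c j * R c i)⁻¹)
  | pr3 (i : Fin (n - 1)) : UVRel n c (R c i * R c i)
  | cr (i j : Fin (n - 1)) (t l : Fin c) (h : FarApart i j) :
      UVRel n c ((S i t * S j l) * (S j l * S i t)⁻¹)
  | mr1 (i j : Fin (n - 1)) (t : Fin c) (h : FarApart i j) :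
      UVRel n c ((S i t * R c j) * (R c j * S i t)⁻¹)
  | mr2 (i j : Fin (n - 1)) (t : Fin c) (h : j.val = i.val + 1) :
      UVRel n c ((R c i * R c j * S i t) * (S j t * R c i * R c j)⁻¹)

/-- The universal virtual braid group `UV_n(c)`. -/
abbrev UV (n c : ℕ) : Type := PresentedGroup {r | UVRel n c r}

namespace UV

/-- The generator `σ_{i,t}` of `UV_n(c)`. -/
def sigma {n c : ℕ} (i : Fin (n - 1)) (t : Fin c) : UV n c := PresentedGroup.of (UVGen.sigma i t)

/-- The generator `ρ_i` of `UV_n(c)`. -/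
def rho {n : ℕ} (c : ℕ) (i : Fin (n - 1)) : UV n c := PresentedGroup.of (UVGen.rho i)

end UV

/-! ### The two maps onto the symmetric group and their kernels -/

/-- The adjacent transposition `s_i = (i  i+1)` of `{0, …, n - 1}`. -/
def adjSwap {n : ℕ} (i : Fin (n - 1)) : Equiv.Perm (Fin n) :=
  Equiv.swap ⟨i.val, by omega⟩ ⟨i.val + 1, by omega⟩

theorem adjSwap_mul_self {n : ℕ} (i : Fin (n - 1)) : adjSwap i * adjSwap i = 1 :=
  Equiv.swap_mul_self _ _

theorem adjSwap_braid {n : ℕ} (i j : Fin (n - 1)) (h : j.val = i.val + 1) :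
    adjSwap i * adjSwap j * adjSwap i = adjSwap j * adjSwap i * adjSwap j := by
  obtain ⟨i, hi⟩ := i
  obtain ⟨j, hj⟩ := j
  simp only at h
  subst h
  ext ⟨x, hx⟩
  simp only [adjSwap, Equiv.Perm.mul_apply, Equiv.swap_apply_def]
  grind

theorem adjSwap_comm {n : ℕ} (i j : Fin (n - 1)) (h : FarApart i j) :
    adjSwap i * adjSwap j = adjSwap j * adjSwap i := by
  obtain ⟨i, hi⟩ := i
  obtain ⟨j, hj⟩ := j
  simp only [FarApart] at h
  ext ⟨x, hx⟩
  simp only [adjSwap, Equiv.Perm.mul_apply, Equiv.swap_apply_def]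
  grind

/-- The assignment `σ_{i,t} ↦ s_i`, `ρ_i ↦ s_i`. -/
def genP {n c : ℕ} : UVGen n c → Equiv.Perm (Fin n)
  | .sigma i _ => adjSwap i
  | .rho i => adjSwap i

/-- The assignment `σ_{i,t} ↦ 1`, `ρ_i ↦ s_i`. -/
def genK {n c : ℕ} : UVGen n c → Equiv.Perm (Fin n)
  | .sigma _ _ => 1
  | .rho i => adjSwap i

theorem genP_rel (n c : ℕ) :
    ∀ r ∈ {r | UVRel n c r}, FreeGroup.lift (genP (n := n) (c := c)) r = 1 := by
  rintro r (h : UVRel n c r)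
  cases h <;> simp only [UVGen.R, UVGen.S, map_mul, map_inv, FreeGroup.lift_apply_of, genP,
    mul_inv_eq_one]
  case pr1 i j h => exact adjSwap_braid i j h
  case pr2 i j h => exact adjSwap_comm i j h
  case pr3 i => exact adjSwap_mul_self i
  case cr i j t l h => exact adjSwap_comm i j h
  case mr1 i j t h => exact adjSwap_comm i j h
  case mr2 i j t h => exact adjSwap_braid i j h

theorem genK_rel (n c : ℕ) :
    ∀ r ∈ {r | UVRel n c r}, FreeGroup.lift (genK (n := n) (c := c)) r = 1 := by
  rintro r (h : UVRel n c r)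
  cases h <;> simp only [UVGen.R, UVGen.S, map_mul, map_inv, FreeGroup.lift_apply_of, genK,
    mul_inv_eq_one, mul_one, one_mul, inv_one]
  case pr1 i j h => exact adjSwap_braid i j h
  case pr2 i j h => exact adjSwap_comm i j h
  case pr3 i => exact adjSwap_mul_self i

/-- The homomorphism `π_n^P : UV_n(c) → S_n` with `σ_{i,t} ↦ s_i` and `ρ_i ↦ s_i`. -/
def piP (n c : ℕ) : UV n c →* Equiv.Perm (Fin n) := PresentedGroup.toGroup (genP_rel n c)

/-- The homomorphism `π_n^K : UV_n(c) → S_n` with `σ_{i,t} ↦ 1` and `ρ_i ↦ s_i`. -/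
def piK (n c : ℕ) : UV n c →* Equiv.Perm (Fin n) := PresentedGroup.toGroup (genK_rel n c)

/-- The pure universal virtual braid group `PUV_n(c)`. -/
def PUV (n c : ℕ) : Subgroup (UV n c) := (piP n c).ker

/-- The kernel universal virtual braid group `KUV_n(c)`. -/
def KUV (n c : ℕ) : Subgroup (UV n c) := (piK n c).ker

/-! ### Right-angled Artin groups and the defining graph of `KUV_n(c)` -/

/-- The right-angled Artin group `A(Γ) = ⟨V ∣ v w = w v for all edges {v, w}⟩`. -/
abbrev RAAG {V : Type*} (Γ : SimpleGraph V) : Type _ :=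
  PresentedGroup {r : FreeGroup V | ∃ v w, Γ.Adj v w ∧
    r = (FreeGroup.of v * FreeGroup.of w) * (FreeGroup.of w * FreeGroup.of v)⁻¹}

/-- The generator of `A(Γ)` corresponding to a vertex. -/
def RAAG.of {V : Type*} (Γ : SimpleGraph V) (v : V) : RAAG Γ := PresentedGroup.of v

/-- `v₁ - v₂ - v₃` is an induced path of length two. -/
def IsInducedPathTwo {V : Type*} (Γ : SimpleGraph V) (v₁ v₂ v₃ : V) : Prop :=
  v₁ ≠ v₃ ∧ Γ.Adj v₁ v₂ ∧ Γ.Adj v₂ v₃ ∧ ¬ Γ.Adj v₁ v₃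

/-- Index triples `(i, j, t)` with `i ≠ j` strands and `t` a crossing type. -/
@[ext] structure KUVVertex (n c : ℕ) : Type where
  i : Fin n
  j : Fin n
  ne : i ≠ j
  t : Fin c

/-- The graph on the triples `(i, j, t)`, where `(i, j, t)` and `(k, l, m)` are adjacent if and
only if `i, j, k, l` are pairwise distinct. -/
def kuvGraph (n c : ℕ) : SimpleGraph (KUVVertex n c) where
  Adj v w := v.i ≠ w.i ∧ v.i ≠ w.j ∧ v.j ≠ w.i ∧ v.j ≠ w.j
  symm := ⟨fun _ _ h => ⟨h.1.symm, h.2.2.1.symm, h.2.1.symm, h.2.2.2.symm⟩⟩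
  loopless := ⟨fun _ h => h.1 rfl⟩

/-- The descending word `ρ_{i+d} ρ_{i+d-1} ⋯ ρ_{i+1}` (trivial for `d = 0`). -/
def rhoDesc {n : ℕ} (c i : ℕ) : (d : ℕ) → i + d < n - 1 → UV n c
  | 0, _ => 1
  | d + 1, h => UV.rho c ⟨i + (d + 1), h⟩ * rhoDesc c i d (by omega)

/-- The elements `δ_{i,j,t}`: for `i < j` and `w = ρ_{j-1} ρ_{j-2} ⋯ ρ_{i+1}` (trivial if
`j = i + 1`), `δ_{i,j,t} = w σ_{i,t} w⁻¹` and `δ_{j,i,t} = w ρ_i σ_{i,t} ρ_i w⁻¹`. Since the `ρ_k`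
are involutions, `w⁻¹ = ρ_{i+1} ⋯ ρ_{j-2} ρ_{j-1}`. -/
def delta {n c : ℕ} (v : KUVVertex n c) : UV n c :=
  if h : v.i < v.j then
    let w : UV n c := rhoDesc c v.i.val (v.j.val - v.i.val - 1) (by omega)
    w * UV.sigma ⟨v.i.val, by omega⟩ v.t * w⁻¹
  else
    have hlt : v.j < v.i := lt_of_le_of_ne (not_lt.mp h) (Ne.symm v.ne)
    let w : UV n c := rhoDesc c v.j.val (v.i.val - v.j.val - 1) (by omega)
    let r : UV n c := UV.rho c ⟨v.j.val, by omega⟩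
    w * r * UV.sigma ⟨v.j.val, by omega⟩ v.t * r * w⁻¹

/-! ### Howson groups -/

/-! The key fact is the splitting `UV n c` ≅ A(Γ) ⋊ S_n, where S_n permutes the strand indices of
the vertices. The ρ_i generate a copy of S_n (`eq_one_of_piK_eq_one`), and δ_{i,j,t} is the
conjugate of σ_{0,t} by any element of this copy carrying the strands (0,1) to (i,j): two choices
differ by a product of ρ_k with k ≥ 2, which commutes with σ_{0,t}. Hence S_n permutes the δ's,
those with disjoint strand pairs commute, and v ↦ δ_v defines a map out of A(Γ). It is injective
because `toSemidirect` undoes it, and its image is the kernel of `piK`.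

For n ≤ 3 there are no two disjoint pairs of strands, so Γ has no edges and `KUV n c` is free of
finite rank. Howson's theorem for free groups applies, and the property passes up from finite index
subgroups and down to all subgroups.

For n ≥ 4 an induced path gives F₂ × ℤ with z central. The intersection of ⟨x, y⟩ and ⟨x, yz⟩
contains every y⁻ᵏxyᵏ, while a map to the affine group of ℚ sends the intersection to translations
and these elements to translations with unbounded denominators, which excludes finite generation.
The argument needs only powers of the three generators, so it also reaches `PUV n c`, which contains
the squares δ². -/

theorem Subgroup.FG.of_map_injective {G H : Type*} [Group G] [Group H] {f : G →* H}
    (hf : Function.Injective f) {K : Subgroup G} (hK : (K.map f).FG) : K.FG := by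
  have e : K ≃* K.map f := K.equivMapOfInjective f hf
  rw [← Group.fg_iff_subgroup_fg] at hK ⊢
  exact Group.fg_of_surjective (f := e.symm.toMonoidHom) e.symm.surjective

theorem Subgroup.FG.map_hom {G H : Type*} [Group G] [Group H] (f : G →* H) {K : Subgroup G}
    (hK : K.FG) : (K.map f).FG := by
  rw [← Group.fg_iff_subgroup_fg] at hK ⊢
  exact Group.fg_of_surjective (f := f.subgroupMap K) (f.subgroupMap_surjective K)

theorem IsHowson.of_injective {G H : Type*} [Group G] [Group H] (f : G →* H)
    (hf : Function.Injective f) (hH : IsHowson H) : IsHowson G := by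
  intro A B hA hB
  apply Subgroup.FG.of_map_injective hf
  rw [Subgroup.map_inf _ _ _ hf]
  exact hH _ _ (hA.map_hom f) (hB.map_hom f)

theorem Subgroup.FG.inf_finiteIndex {G : Type*} [Group G] {A : Subgroup G} (hA : A.FG)
    (K : Subgroup G) [K.FiniteIndex] : (A ⊓ K).FG := by
  have : Group.FG A := (Group.fg_iff_subgroup_fg A).2 hA
  have h : (K.subgroupOf A).FG := (Group.fg_iff_subgroup_fg _).1 inferInstance
  have := h.map_hom A.subtype
  rwa [Subgroup.subgroupOf_map_subtype, inf_comm] at this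

/-- The intersection with K has finite index in A, so its generators together with coset
representatives generate A. -/
theorem Subgroup.FG.of_inf_finiteIndex {G : Type*} [Group G] {A : Subgroup G}
    (K : Subgroup G) [K.FiniteIndex] (h : (A ⊓ K).FG) : A.FG := by
  obtain ⟨S, hS, hSf⟩ := (Subgroup.fg_iff _).1 h
  have hfin : Finite (A ⧸ K.subgroupOf A) := inferInstance
  rw [Subgroup.fg_iff]
  refine ⟨S ∪ Set.range fun q : A ⧸ K.subgroupOf A => (q.out : G), ?_,
    hSf.union (Set.finite_range _)⟩
  apply le_antisymm
  · rw [Subgroup.closure_le]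
    rintro x (hx | ⟨q, rfl⟩)
    · exact (hS ▸ Subgroup.subset_closure hx : x ∈ A ⊓ K).1
    · exact q.out.2
  · intro a ha
    set q : A ⧸ K.subgroupOf A := QuotientGroup.mk ⟨a, ha⟩
    have h1 : (q.out)⁻¹ * ⟨a, ha⟩ ∈ K.subgroupOf A :=
      QuotientGroup.eq.1 (QuotientGroup.out_eq' q)
    have h2 : (q.out : G)⁻¹ * a ∈ A ⊓ K :=
      ⟨A.mul_mem (A.inv_mem q.out.2) ha, by simpa [Subgroup.mem_subgroupOf] using h1⟩
    rw [← hS] at h2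
    have h3 := Subgroup.mul_mem _
      (Subgroup.subset_closure (Or.inr ⟨q, rfl⟩) : (q.out : G) ∈ Subgroup.closure
        (S ∪ Set.range fun q : A ⧸ K.subgroupOf A => (q.out : G)))
      (Subgroup.closure_mono Set.subset_union_left h2)
    simpa using h3

theorem IsHowson.of_finiteIndex {G : Type*} [Group G] (K : Subgroup G) [K.FiniteIndex]
    (hK : IsHowson K) : IsHowson G := by
  intro A B hA hB
  have key : ∀ {A : Subgroup G}, A.FG → (A.subgroupOf K).FG := fun {A} hA => by
    apply Subgroup.FG.of_map_injective K.subtype_injective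
    rw [Subgroup.subgroupOf_map_subtype]
    exact hA.inf_finiteIndex K
  apply Subgroup.FG.of_inf_finiteIndex K
  have h := (hK _ _ (key hA) (key hB)).map_hom K.subtype
  rw [Subgroup.map_inf _ _ _ K.subtype_injective, Subgroup.subgroupOf_map_subtype,
    Subgroup.subgroupOf_map_subtype] at h
  rwa [show A ⊓ B ⊓ K = A ⊓ K ⊓ (B ⊓ K) by
    rw [inf_inf_distrib_right]]

/-! ### Howson's theorem for free groups -/

theorem List.suffix_append_or_of_suffix {β : Type*} {s L₁ L₂ : List β} (h : s <:+ L₁ ++ L₂) :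
    s <:+ L₂ ∨ ∃ t, t <:+ L₁ ∧ s = t ++ L₂ := by
  obtain ⟨p, hp⟩ := h
  rcases List.append_eq_append_iff.1 hp with ⟨t, rfl, rfl⟩ | ⟨t, rfl, rfl⟩
  · exact Or.inr ⟨t, ⟨p, rfl⟩, rfl⟩
  · exact Or.inl ⟨t, rfl⟩

namespace FreeGroup

variable {α : Type*}

/-- All suffixes of the word `L` represent left cosets of `H` that belong to `S`. -/
def SuffixCosetsIn (H : Subgroup (FreeGroup α)) (S : Set (FreeGroup α ⧸ H))
    (L : List (α × Bool)) : Prop :=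
  ∀ s, s <:+ L → (QuotientGroup.mk (mk s) : FreeGroup α ⧸ H) ∈ S

theorem SuffixCosetsIn.append {H : Subgroup (FreeGroup α)} {S : Set (FreeGroup α ⧸ H)}
    {L₁ L₂ : List (α × Bool)} (h₁ : SuffixCosetsIn H S L₁) (h₂ : SuffixCosetsIn H S L₂)
    (hL : mk L₂ ∈ H) : SuffixCosetsIn H S (L₁ ++ L₂) := by
  intro s hs
  rcases List.suffix_append_or_of_suffix hs with h | ⟨t, ht, rfl⟩
  · exact h₂ s h
  · rw [← mul_mk, QuotientGroup.mk_mul_of_mem _ hL]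
    exact h₁ t ht

/-- If L⁻¹ = ps then L = s⁻¹p⁻¹, so sL = p⁻¹; as L lies in H, the coset of s is that of the suffix
p⁻¹ of L. -/
theorem SuffixCosetsIn.invRev {H : Subgroup (FreeGroup α)} {S : Set (FreeGroup α ⧸ H)}
    {L : List (α × Bool)} (h : SuffixCosetsIn H S L) (hL : mk L ∈ H) :
    SuffixCosetsIn H S (invRev L) := by
  rintro s ⟨p, hp⟩
  have hL' : L = FreeGroup.invRev s ++ FreeGroup.invRev p := by
    rw [← invRev_append, hp, invRev_invRev]
  have hs := h (FreeGroup.invRev p) ⟨_, hL'.symm⟩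
  rw [hL', ← mul_mk, ← inv_mk, ← inv_mk] at hL
  rw [← inv_mk] at hs
  convert hs using 1
  rw [QuotientGroup.eq]
  exact hL

/-- Every suffix of the reduced word equals, as a group element, some suffix of the unreduced one.
-/
theorem SuffixCosetsIn.red {H : Subgroup (FreeGroup α)} {S : Set (FreeGroup α ⧸ H)}
    {L L' : List (α × Bool)} (h : SuffixCosetsIn H S L) (hr : Red L L') :
    SuffixCosetsIn H S L' := by
  induction hr with
  | refl => exact h
  | tail _ hs ih =>
    obtain @⟨L₁, L₂, x, b⟩ := hs
    intro s hs
    rcases List.suffix_append_or_of_suffix hs with h | ⟨t, ht, rfl⟩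
    · exact ih s (h.trans ⟨L₁ ++ [(x, b), (x, !b)], by simp⟩)
    · have : mk (t ++ L₂) = mk (t ++ (x, b) :: (x, !b) :: L₂) := by
        rw [eq_comm]
        exact Quot.sound Red.Step.not
      rw [this]
      apply ih
      obtain ⟨p, rfl⟩ := ht
      exact ⟨p, by simp⟩

/-- S is the finite core of the coset graph: the vertices visited when the generators are read from
right to left, starting at H. -/
theorem exists_finite_suffixCosetsIn [DecidableEq α] {H : Subgroup (FreeGroup α)} (hH : H.FG) :
    ∃ S : Set (FreeGroup α ⧸ H), S.Finite ∧ ∀ h ∈ H, SuffixCosetsIn H S h.toWord := by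
  obtain ⟨T, hT, hTf⟩ := (Subgroup.fg_iff _).1 hH
  refine ⟨⋃ h ∈ insert 1 T, (fun s => (QuotientGroup.mk (mk s) : FreeGroup α ⧸ H)) ''
    {s | s ∈ h.toWord.tails}, ?_, ?_⟩
  · exact (hTf.insert 1).biUnion fun h _ => (List.finite_toSet _).image _
  set S := ⋃ h ∈ insert 1 T, (fun s => (QuotientGroup.mk (mk s) : FreeGroup α ⧸ H)) ''
    {s | s ∈ h.toWord.tails} with hS
  have base : ∀ h ∈ insert 1 T, SuffixCosetsIn H S h.toWord := fun h hh s hs =>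
    Set.mem_biUnion hh ⟨s, by simpa using hs, rfl⟩
  intro h hh
  -- Membership in H is carried along because the product and inverse cases need it.
  suffices h ∈ H ∧ SuffixCosetsIn H S h.toWord from this.2
  clear_value S
  rw [← hT] at hh
  induction hh using Subgroup.closure_induction with
  | mem x hx => exact ⟨hT ▸ Subgroup.subset_closure hx, base x (Or.inr hx)⟩
  | one => exact ⟨H.one_mem, base 1 (Or.inl rfl)⟩
  | mul x y _ _ hx hy =>
    refine ⟨H.mul_mem hx.1 hy.1, ?_⟩
    rw [toWord_mul]
    exact (hx.2.append hy.2 (by rw [mk_toWord]; exact hy.1)).red reduce.red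
  | inv x _ hx =>
    refine ⟨H.inv_mem hx.1, ?_⟩
    rw [toWord_inv]
    exact hx.2.invRev (by rw [mk_toWord]; exact hx.1)

-- Schreier's argument. Reading h letter by letter telescopes it into factors r(xq)⁻¹ x r(q), and
-- the cosets q met on the way lie in S, so finitely many factors suffice.
open Classical in
theorem fg_of_suffixCosetsIn [Finite α] {H : Subgroup (FreeGroup α)}
    {S : Set (FreeGroup α ⧸ H)} (hSf : S.Finite) (hS : ∀ h ∈ H, SuffixCosetsIn H S h.toWord) :
    H.FG := by
  -- The section is normalised by r(H) = 1, so that r(hH)⁻¹h is h itself for h in H.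
  let r : FreeGroup α ⧸ H → FreeGroup α := fun q =>
    if q = QuotientGroup.mk 1 then 1 else q.out
  have hr : ∀ q, (QuotientGroup.mk (r q) : FreeGroup α ⧸ H) = q := by
    intro q
    by_cases hq : q = QuotientGroup.mk 1
    · simp only [r, hq, if_true]
    · simp only [r, hq, if_false]
      exact QuotientGroup.out_eq' q
  let g : (FreeGroup α ⧸ H) × (α × Bool) → FreeGroup α := fun p =>
    (r (mk [p.2] • p.1))⁻¹ * mk [p.2] * r p.1
  rw [Subgroup.fg_iff]
  refine ⟨g '' (S ×ˢ Set.univ), ?_, (hSf.prod Set.finite_univ).image _⟩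
  apply le_antisymm
  · rw [Subgroup.closure_le]
    rintro _ ⟨⟨q, x⟩, -, rfl⟩
    change (r (mk [x] • q))⁻¹ * mk [x] * r q ∈ H
    rw [mul_assoc, ← QuotientGroup.eq, hr]
    conv_lhs => rw [← hr q]
    rfl
  · have key : ∀ L : List (α × Bool), SuffixCosetsIn H S L →
        (r (QuotientGroup.mk (mk L)))⁻¹ * mk L ∈ Subgroup.closure (g '' (S ×ˢ Set.univ)) := by
      intro L
      induction L with
      | nil =>
        intro _
        have : (mk [] : FreeGroup α) = 1 := rfl
        simp [this, r]
      | cons x L ih =>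
        intro hL
        have h1 := ih fun s hs => hL s (hs.trans (List.suffix_cons x L))
        have h2 : g (QuotientGroup.mk (mk L), x) ∈ Subgroup.closure (g '' (S ×ˢ Set.univ)) :=
          Subgroup.subset_closure ⟨_, ⟨hL _ (List.suffix_cons x L), trivial⟩, rfl⟩
        have h3 := Subgroup.mul_mem _ h2 h1
        have h4 : (mk (x :: L) : FreeGroup α) = mk [x] * mk L := by rw [mul_mk]; rfl
        have h5 : (mk [x] • QuotientGroup.mk (mk L) : FreeGroup α ⧸ H) =
            QuotientGroup.mk (mk (x :: L)) := by rw [h4]; rfl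
        simp only [g, h5] at h3
        convert h3 using 1
        rw [h4]
        group
    intro h hh
    have h1 := key h.toWord (hS h hh)
    have h2 : (QuotientGroup.mk h : FreeGroup α ⧸ H) = QuotientGroup.mk 1 := by
      rw [eq_comm, QuotientGroup.eq]
      simpa using hh
    simpa [mk_toWord, h2, r] using h1

/-- **Howson's theorem** for free groups of finite rank. -/
theorem isHowson [Finite α] : IsHowson (FreeGroup α) := by
  classical
  intro A B hA hB
  obtain ⟨S, hSf, hS⟩ := exists_finite_suffixCosetsIn hA
  obtain ⟨T, hTf, hT⟩ := exists_finite_suffixCosetsIn hB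
  -- A coset of the intersection is determined by its cosets modulo A and B, so finite cores for A
  -- and B yield one for the intersection.
  let p : FreeGroup α ⧸ (A ⊓ B) → (FreeGroup α ⧸ A) × (FreeGroup α ⧸ B) := fun q =>
    (Subgroup.quotientMapOfLE inf_le_left q, Subgroup.quotientMapOfLE inf_le_right q)
  have hp : Function.Injective p := by
    intro x y hxy
    induction x using QuotientGroup.induction_on with | _ x
    induction y using QuotientGroup.induction_on with | _ y
    have h1 := congrArg Prod.fst hxy
    have h2 := congrArg Prod.snd hxy
    simp only [p, Subgroup.quotientMapOfLE_apply_mk] at h1 h2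
    rw [QuotientGroup.eq] at h1 h2 ⊢
    exact ⟨h1, h2⟩
  apply fg_of_suffixCosetsIn (S := p ⁻¹' (S ×ˢ T)) ((hSf.prod hTf).preimage hp.injOn)
  intro h hh s hs
  exact ⟨hS h hh.1 s hs, hT h hh.2 s hs⟩

end FreeGroup

/-! ### Groups that are not Howson -/

/-- The action of `ℚˣ` on the additive group of `ℚ` by multiplication. -/
def ratUnitsAut : ℚˣ →* MulAut (Multiplicative ℚ) :=
  (MulAutMultiplicative ℚ).symm.toMonoidHom.comp (DistribMulAction.toAddAut ℚˣ ℚ)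

theorem ratUnitsAut_ofAdd (u : ℚˣ) (b : ℚ) :
    ratUnitsAut u (Multiplicative.ofAdd b) = Multiplicative.ofAdd (u * b) := rfl

/-- The affine group of the rational line. -/
abbrev RatAffine : Type := Multiplicative ℚ ⋊[ratUnitsAut] ℚˣ

theorem exists_common_denominator {G : Type*} (u : G → ℚ) {S : Set G} (hS : S.Finite) :
    ∃ D : ℤ, D ≠ 0 ∧ ∀ s ∈ S, ∃ z : ℤ, D * u s = z := by
  induction S, hS using Set.Finite.induction_on with
  | empty => exact ⟨1, one_ne_zero, by simp⟩
  | @insert a S _ _ ih =>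
    obtain ⟨D, hD, h⟩ := ih
    refine ⟨(u a).den * D, mul_ne_zero (by simp) hD, ?_⟩
    rintro s (rfl | hs)
    · refine ⟨D * (u s).num, ?_⟩
      push_cast
      rw [mul_right_comm, mul_comm ((u s).den : ℚ), Rat.mul_den_eq_num, mul_comm]
    · obtain ⟨z, hz⟩ := h s hs
      refine ⟨(u a).den * z, ?_⟩
      push_cast
      rw [mul_assoc, hz]

/-- With trivial linear part on K, the translation part is additive there, so a common denominator
for the generators serves all of K. -/
theorem exists_common_denominator_of_fg {G : Type*} [Group G] (f : G →* RatAffine)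
    {K : Subgroup G} (hK : K.FG) (hr : ∀ w ∈ K, (f w).right = 1) :
    ∃ D : ℤ, D ≠ 0 ∧ ∀ w ∈ K, ∃ z : ℤ, D * (f w).left.toAdd = z := by
  obtain ⟨S, hS, hSf⟩ := (Subgroup.fg_iff _).1 hK
  obtain ⟨D, hD, h⟩ := exists_common_denominator (fun w => (f w).left.toAdd) hSf
  refine ⟨D, hD, fun w hw => ?_⟩
  rw [← hS] at hw hr
  induction hw using Subgroup.closure_induction with
  | mem x hx => exact h x hx
  | one => exact ⟨0, by simp⟩
  | mul x y hx hy ihx ihy =>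
    obtain ⟨a, ha⟩ := ihx
    obtain ⟨b, hb⟩ := ihy
    refine ⟨a + b, ?_⟩
    push_cast
    rw [← ha, ← hb, map_mul, SemidirectProduct.mul_left, hr x hx]
    simp [mul_add]
  | inv x hx ihx =>
    obtain ⟨a, ha⟩ := ihx
    refine ⟨-a, ?_⟩
    push_cast
    rw [← ha, map_inv, SemidirectProduct.inv_left, hr x hx]
    simp

/-- Here x acts as a translation and y as a dilation, while e detects z. On ⟨x, y⟩ the map e is
trivial, and on ⟨x, yz⟩ it equals the linear part of f, so f sends the intersection to translations.
-/
theorem not_isHowson_of_hom_ratAffine {G : Type*} [Group G] {x y z : G} (hxz : Commute x z)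
    (hyz : Commute y z) (f : G →* RatAffine) (e : G →* ℚˣ) {q : ℚˣ} (hq : (1 : ℚ) < q) {a : ℚ}
    (ha : a ≠ 0) (hfx : f x = SemidirectProduct.inl (Multiplicative.ofAdd a))
    (hfy : f y = SemidirectProduct.inr q) (hfz : f z = 1) (hex : e x = 1) (hey : e y = 1)
    (hez : e z = q) : ¬ IsHowson G := by
  intro h
  have hA : ∀ w ∈ Subgroup.closure {x, y}, e w = 1 := by
    intro w hw
    suffices Subgroup.closure {x, y} ≤ e.ker from this hw
    rw [Subgroup.closure_le]
    rintro _ (rfl | rfl)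
    exacts [hex, hey]
  have hB : ∀ w ∈ Subgroup.closure {x, y * z}, (f w).right = e w := by
    intro w hw
    suffices Subgroup.closure {x, y * z} ≤ (SemidirectProduct.rightHom.comp f).eqLocus e from
      this hw
    rw [Subgroup.closure_le]
    rintro w (hw | hw) <;> rw [hw]
    · change (f x).right = e x
      rw [hfx, hex, SemidirectProduct.right_inl]
    · change (f (y * z)).right = e (y * z)
      rw [map_mul, map_mul, hfy, hfz, hey, hez, mul_one, one_mul, SemidirectProduct.right_inr]
  have hfg := h (Subgroup.closure {x, y}) (Subgroup.closure {x, y * z})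
    ((Subgroup.fg_iff _).2 ⟨_, rfl, Set.toFinite _⟩) ((Subgroup.fg_iff _).2 ⟨_, rfl, Set.toFinite _⟩)
  obtain ⟨D, hD, hDz⟩ := exists_common_denominator_of_fg f hfg
    fun w hw => (hB w hw.2).trans (hA w hw.1)
  -- Since z commutes with x and y, conjugating x by (yz)ᵏ or by yᵏ gives the same element.
  have hmem : ∀ k : ℕ, (y ^ k)⁻¹ * x * y ^ k ∈
      Subgroup.closure {x, y} ⊓ Subgroup.closure {x, y * z} := by
    intro k
    have key : ∀ {S : Subgroup G} {y}, x ∈ S → y ∈ S → (y ^ k)⁻¹ * x * y ^ k ∈ S :=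
      fun hx hy => mul_mem (mul_mem (inv_mem (pow_mem hy k)) hx) (pow_mem hy k)
    refine ⟨key (Subgroup.subset_closure (by simp)) (Subgroup.subset_closure (by simp)), ?_⟩
    have : (y ^ k)⁻¹ * x * y ^ k = ((y * z) ^ k)⁻¹ * x * (y * z) ^ k := by
      have hc : Commute ((y ^ k)⁻¹ * x * y ^ k) (z ^ k) :=
        (((hyz.pow_left k).inv_left.mul_left hxz).mul_left (hyz.pow_left k)).pow_right k
      calc (y ^ k)⁻¹ * x * y ^ k = (z ^ k)⁻¹ * ((y ^ k)⁻¹ * x * y ^ k * z ^ k) := by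
            rw [hc.eq, inv_mul_cancel_left]
        _ = ((y * z) ^ k)⁻¹ * x * (y * z) ^ k := by
            rw [hyz.mul_pow]
            simp only [mul_inv_rev, mul_assoc]
    rw [this]
    exact key (Subgroup.subset_closure (by simp)) (Subgroup.subset_closure (by simp))
  -- With qᵏ > |Da|, the number m = Da/qᵏ would be a nonzero integer of absolute value less than 1.
  obtain ⟨k, hk⟩ := pow_unbounded_of_one_lt |(D : ℚ) * a| hq
  obtain ⟨m, hm⟩ := hDz _ (hmem k)
  have hval : f ((y ^ k)⁻¹ * x * y ^ k) =
      SemidirectProduct.inl (Multiplicative.ofAdd (((q ^ k)⁻¹ : ℚˣ) * a)) := by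
    rw [← ratUnitsAut_ofAdd, SemidirectProduct.inl_aut, map_mul, map_mul, map_inv, map_pow, hfx,
      hfy, inv_inv, map_inv, map_pow]
  rw [hval, SemidirectProduct.left_inl, toAdd_ofAdd] at hm
  have hqk : (0 : ℚ) < (q : ℚ) ^ k := pow_pos (zero_lt_one.trans hq) k
  have hm' : (D : ℚ) * a = m * (q : ℚ) ^ k := by
    rw [← hm]
    push_cast
    field_simp
  have hm0 : m ≠ 0 := by
    rintro rfl
    apply mul_ne_zero (Int.cast_ne_zero.2 hD) ha
    rw [hm']
    simp
  rw [hm', abs_mul, abs_of_pos hqk] at hk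
  have : (1 : ℚ) ≤ |(m : ℚ)| := by exact_mod_cast Int.one_le_abs hm0
  nlinarith

/-! ### Right-angled Artin groups and the obstruction from an induced path -/

theorem RAAG.commute_of {V : Type*} {Γ : SimpleGraph V} {v w : V} (h : Γ.Adj v w) :
    Commute (RAAG.of Γ v) (RAAG.of Γ w) :=
  PresentedGroup.mk_eq_mk_of_mul_inv_mem ⟨v, w, h, rfl⟩

/-- The homomorphism from a right-angled Artin group given by a map on the vertices. -/
def RAAG.lift {V G : Type*} [Group G] {Γ : SimpleGraph V} (f : V → G)
    (hf : ∀ v w, Γ.Adj v w → Commute (f v) (f w)) : RAAG Γ →* G :=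
  PresentedGroup.toGroup (f := f) (by
    rintro _ ⟨v, w, h, rfl⟩
    simp only [map_mul, map_inv, FreeGroup.lift_apply_of, mul_inv_eq_one]
    exact hf v w h)

@[simp]
theorem RAAG.lift_of {V G : Type*} [Group G] {Γ : SimpleGraph V} (f : V → G)
    (hf : ∀ v w, Γ.Adj v w → Commute (f v) (f w)) (v : V) : RAAG.lift f hf (RAAG.of Γ v) = f v :=
  PresentedGroup.toGroup.of _

theorem RAAG.hom_ext {V G : Type*} [Group G] {Γ : SimpleGraph V} {f g : RAAG Γ →* G}
    (h : ∀ v, f (RAAG.of Γ v) = g (RAAG.of Γ v)) : f = g :=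
  PresentedGroup.ext h

theorem RAAG.not_isHowson_of_pow_mem {V : Type*} {Γ : SimpleGraph V} {v₁ v₂ v₃ : V}
    (h : IsInducedPathTwo Γ v₁ v₂ v₃) {m : ℕ} (hm : m ≠ 0) {K : Subgroup (RAAG Γ)}
    (h₁ : RAAG.of Γ v₁ ^ m ∈ K) (h₂ : RAAG.of Γ v₂ ^ m ∈ K) (h₃ : RAAG.of Γ v₃ ^ m ∈ K) :
    ¬ IsHowson K := by
  classical
  obtain ⟨h13, a12, a23, a13⟩ := h
  have h12 := a12.ne
  have h23 := a23.ne
  let u : ℚˣ := Units.mk0 2 two_ne_zero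
  -- Only v₁ and v₃ have nontrivial images, and these two are not adjacent, so every defining
  -- relation is respected.
  let f : RAAG Γ →* RatAffine := RAAG.lift
    (fun v => if v = v₁ then SemidirectProduct.inl (Multiplicative.ofAdd 1)
      else if v = v₃ then SemidirectProduct.inr u else 1) (by
    intro v w hvw
    by_cases hv1 : v = v₁ <;> by_cases hv3 : v = v₃ <;> by_cases hw1 : w = v₁ <;>
      by_cases hw3 : w = v₃ <;> simp_all [Commute.one_left, Commute.one_right, Γ.adj_comm])
  let e : RAAG Γ →* ℚˣ := RAAG.lift (fun v => if v = v₂ then u else 1)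
    fun _ _ _ => Commute.all _ _
  refine not_isHowson_of_hom_ratAffine (x := (⟨_, h₁⟩ : K)) (y := ⟨_, h₃⟩) (z := ⟨_, h₂⟩)
    (q := u ^ m) (a := m) ?_ ?_ (f.comp K.subtype) (e.comp K.subtype) ?_ ?_ ?_ ?_ ?_ ?_ ?_ ?_
  · exact Subtype.ext ((RAAG.commute_of a12).pow_pow m m).eq
  · exact Subtype.ext ((RAAG.commute_of a23.symm).pow_pow m m).eq
  · simpa [u] using one_lt_pow₀ (by norm_num : (1 : ℚ) < 2) hm
  · exact_mod_cast hm
  · simp only [MonoidHom.comp_apply, Subgroup.coe_subtype, map_pow, f, RAAG.lift_of, if_true]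
    rw [← map_pow, ← ofAdd_nsmul, nsmul_one]
  · simp [f, h13.symm]
  · simp [f, h12.symm, h23]
  · simp [e, h12]
  · simp [e, h23.symm]
  · simp [e]

/-! ### The subgroup of `UV_n(c)` generated by the `ρ_i` -/

theorem adjSwap_apply_val {n : ℕ} (i : Fin (n - 1)) (x : Fin n) :
    (adjSwap i x).val = if x.val = i.val then i.val + 1 else if x.val = i.val + 1 then i.val
      else x.val := by
  simp only [adjSwap, Equiv.swap_apply_def, Fin.ext_iff]
  split_ifs <;> rfl

namespace UV

/-- The generator `ρ_i`, extended by `1` to all natural indices. -/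
def rhoNat (n c i : ℕ) : UV n c := if h : i < n - 1 then rho c ⟨i, h⟩ else 1

/-- The generator `σ_{i,t}`, extended by `1` to all natural indices. -/
def sigmaNat (n : ℕ) {c : ℕ} (t : Fin c) (i : ℕ) : UV n c :=
  if h : i < n - 1 then sigma ⟨i, h⟩ t else 1

variable {n c : ℕ}

theorem rhoNat_of_lt {i : ℕ} (h : i < n - 1) : rhoNat n c i = rho c ⟨i, h⟩ := dif_pos h

theorem sigmaNat_of_lt (t : Fin c) {i : ℕ} (h : i < n - 1) : sigmaNat n t i = sigma ⟨i, h⟩ t :=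
  dif_pos h

theorem rho_mul_self (i : Fin (n - 1)) : rho c i * rho c i = 1 :=
  PresentedGroup.one_of_mem (rels := {r | UVRel n c r}) (UVRel.pr3 i)

theorem rho_inv (i : Fin (n - 1)) : (rho c i)⁻¹ = rho c i :=
  inv_eq_of_mul_eq_one_left (rho_mul_self i)

theorem commute_rho {i j : Fin (n - 1)} (h : FarApart i j) : Commute (rho c i) (rho c j) :=
  PresentedGroup.mk_eq_mk_of_mul_inv_mem (rels := {r | UVRel n c r}) (UVRel.pr2 i j h)

theorem commute_sigma {i j : Fin (n - 1)} (t l : Fin c) (h : FarApart i j) :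
    Commute (sigma i t) (sigma j l) :=
  PresentedGroup.mk_eq_mk_of_mul_inv_mem (rels := {r | UVRel n c r}) (UVRel.cr i j t l h)

theorem commute_sigma_rho {i j : Fin (n - 1)} (t : Fin c) (h : FarApart i j) :
    Commute (sigma i t) (rho c j) :=
  PresentedGroup.mk_eq_mk_of_mul_inv_mem (rels := {r | UVRel n c r}) (UVRel.mr1 i j t h)

theorem rho_braid {i j : Fin (n - 1)} (h : j.val = i.val + 1) :
    rho c i * rho c j * rho c i = rho c j * rho c i * rho c j :=
  PresentedGroup.mk_eq_mk_of_mul_inv_mem (rels := {r | UVRel n c r}) (UVRel.pr1 i j h)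

theorem rho_rho_sigma {i j : Fin (n - 1)} (t : Fin c) (h : j.val = i.val + 1) :
    rho c i * rho c j * sigma i t = sigma j t * rho c i * rho c j :=
  PresentedGroup.mk_eq_mk_of_mul_inv_mem (rels := {r | UVRel n c r}) (UVRel.mr2 i j t h)

theorem rhoNat_mul_self (i : ℕ) : rhoNat n c i * rhoNat n c i = 1 := by
  unfold rhoNat
  split_ifs
  exacts [rho_mul_self _, one_mul 1]

theorem rhoNat_inv (i : ℕ) : (rhoNat n c i)⁻¹ = rhoNat n c i :=
  inv_eq_of_mul_eq_one_left (rhoNat_mul_self i)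

theorem commute_rhoNat {i j : ℕ} (h : i + 2 ≤ j ∨ j + 2 ≤ i) :
    Commute (rhoNat n c i) (rhoNat n c j) := by
  unfold rhoNat
  split_ifs
  exacts [commute_rho h, Commute.one_right _, Commute.one_left _, Commute.one_left _]

theorem rhoNat_braid {i : ℕ} (h : i + 1 < n - 1) :
    rhoNat n c i * rhoNat n c (i + 1) * rhoNat n c i =
      rhoNat n c (i + 1) * rhoNat n c i * rhoNat n c (i + 1) := by
  rw [rhoNat_of_lt h, rhoNat_of_lt (by omega : i < n - 1)]
  exact rho_braid rfl

@[simp]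
theorem piK_rho (i : Fin (n - 1)) : piK n c (rho c i) = adjSwap i := PresentedGroup.toGroup.of _

@[simp]
theorem piK_sigma (i : Fin (n - 1)) (t : Fin c) : piK n c (sigma i t) = 1 :=
  PresentedGroup.toGroup.of _

theorem piK_rhoNat_apply_val {i : ℕ} (h : i < n - 1) (x : Fin n) :
    (piK n c (rhoNat n c i) x).val =
      if x.val = i then i + 1 else if x.val = i + 1 then i else x.val := by
  rw [rhoNat_of_lt h, piK_rho, adjSwap_apply_val]

/-- The descending product `ρ_{k+d-1} ⋯ ρ_{k+1} ρ_k`. -/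
def desc (n c k : ℕ) : ℕ → UV n c
  | 0 => 1
  | d + 1 => rhoNat n c (k + d) * desc n c k d

theorem rhoNat_mul_desc_of_lt {k d i : ℕ} (h : k + d < i) :
    rhoNat n c i * desc n c k d = desc n c k d * rhoNat n c i := by
  induction d with
  | zero => simp [desc]
  | succ d ih =>
    rw [desc, ← mul_assoc, (commute_rhoNat (by omega) : Commute (rhoNat n c i) _).eq, mul_assoc,
      ih (by omega), mul_assoc]

/-- ρ_i passes the letters above ρ_{i+1}, the braid relation turns ρ_i ρ_{i+1} ρ_i into ρ_{i+1} ρ_i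
ρ_{i+1}, and the last ρ_{i+1} passes the remaining lower letters. -/
theorem rhoNat_mul_desc_of_mem {k d i : ℕ} (h₁ : k ≤ i) (h₂ : i + 1 < k + d) (h₃ : k + d ≤ n - 1) :
    rhoNat n c i * desc n c k d = desc n c k d * rhoNat n c (i + 1) := by
  induction d with
  | zero => omega
  | succ d ih =>
    rcases Nat.lt_or_ge (i + 1) (k + d) with h | h
    · rw [desc, ← mul_assoc, (commute_rhoNat (by omega) : Commute (rhoNat n c i) _).eq, mul_assoc,
        ih h (by omega), mul_assoc]
    · obtain ⟨d, rfl⟩ : ∃ e, d = e + 1 := ⟨d - 1, by omega⟩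
      obtain rfl : i = k + d := by omega
      rw [desc, desc, ← mul_assoc, ← mul_assoc, ← add_assoc, rhoNat_braid (by omega), mul_assoc,
        rhoNat_mul_desc_of_lt (by omega)]
      simp only [mul_assoc]

/-- The subgroup generated by the `ρ_i` with `i ≥ k`. -/
def rhoSubgroup (n c k : ℕ) : Subgroup (UV n c) :=
  Subgroup.closure {x | ∃ i, k ≤ i ∧ i < n - 1 ∧ x = rhoNat n c i}

theorem rhoNat_mem {k i : ℕ} (h₁ : k ≤ i) (h₂ : i < n - 1) : rhoNat n c i ∈ rhoSubgroup n c k :=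
  Subgroup.subset_closure ⟨i, h₁, h₂, rfl⟩

theorem rho_mem (i : Fin (n - 1)) : rho c i ∈ rhoSubgroup n c 0 := by
  rw [← rhoNat_of_lt i.2]
  exact rhoNat_mem (Nat.zero_le _) i.2

theorem desc_mem {k d : ℕ} (h : k + d ≤ n - 1) : desc n c k d ∈ rhoSubgroup n c k := by
  induction d with
  | zero => exact Subgroup.one_mem _
  | succ d ih => exact Subgroup.mul_mem _ (rhoNat_mem (by omega) (by omega)) (ih (by omega))

theorem rhoSubgroup_anti {k l : ℕ} (h : k ≤ l) : rhoSubgroup n c l ≤ rhoSubgroup n c k := by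
  apply Subgroup.closure_mono
  rintro _ ⟨i, h₁, h₂, rfl⟩
  exact ⟨i, h.trans h₁, h₂, rfl⟩

/-- Coset enumeration: the descending words represent all cosets of the next subgroup, since left
multiplication by ρ_i lengthens, shortens or keeps the word, up to a factor in that subgroup. -/
theorem exists_desc_mul {k : ℕ} (hk : k ≤ n - 1) {x : UV n c} (hx : x ∈ rhoSubgroup n c k) :
    ∃ d y, k + d ≤ n - 1 ∧ y ∈ rhoSubgroup n c (k + 1) ∧ x = desc n c k d * y := by
  have step : ∀ i, k ≤ i → i < n - 1 → ∀ x : UV n c,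
      (∃ d y, k + d ≤ n - 1 ∧ y ∈ rhoSubgroup n c (k + 1) ∧ x = desc n c k d * y) →
      ∃ d y, k + d ≤ n - 1 ∧ y ∈ rhoSubgroup n c (k + 1) ∧
        rhoNat n c i * x = desc n c k d * y := by
    rintro i hki hin _ ⟨d, y, hd, hy, rfl⟩
    rcases lt_trichotomy i (k + d) with h | rfl | h
    · rcases Nat.lt_or_ge (i + 1) (k + d) with h' | h'
      · refine ⟨d, rhoNat n c (i + 1) * y, hd,
          Subgroup.mul_mem _ (rhoNat_mem (by omega) (by omega)) hy, ?_⟩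
        rw [← mul_assoc, rhoNat_mul_desc_of_mem hki h' hd, mul_assoc]
      · obtain ⟨e, rfl⟩ : ∃ e, d = e + 1 := ⟨d - 1, by omega⟩
        obtain rfl : i = k + e := by omega
        refine ⟨e, y, by omega, hy, ?_⟩
        rw [desc, ← mul_assoc, ← mul_assoc, rhoNat_mul_self, one_mul]
    · exact ⟨d + 1, y, by omega, hy, by rw [desc, mul_assoc]⟩
    · refine ⟨d, rhoNat n c i * y, hd, Subgroup.mul_mem _ (rhoNat_mem (by omega) hin) hy, ?_⟩
      rw [← mul_assoc, rhoNat_mul_desc_of_lt h, mul_assoc]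
  induction hx using Subgroup.closure_induction_left with
  | one => exact ⟨0, 1, hk, Subgroup.one_mem _, (one_mul 1).symm⟩
  | mul_left x hx y _ ih =>
    obtain ⟨i, h₁, h₂, rfl⟩ := hx
    exact step i h₁ h₂ _ ih
  | inv_mul_cancel x hx y _ ih =>
    obtain ⟨i, h₁, h₂, rfl⟩ := hx
    rw [rhoNat_inv]
    exact step i h₁ h₂ _ ih

theorem piK_apply_of_lt {k : ℕ} {x : UV n c} (hx : x ∈ rhoSubgroup n c k) {a : Fin n}
    (ha : a.val < k) : piK n c x a = a := by
  suffices rhoSubgroup n c k ≤ (MulAction.stabilizer (Equiv.Perm (Fin n)) a).comap (piK n c) from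
    this hx
  rw [rhoSubgroup, Subgroup.closure_le]
  rintro _ ⟨i, h₁, h₂, rfl⟩
  change piK n c (rhoNat n c i) a = a
  ext
  rw [piK_rhoNat_apply_val h₂, if_neg (by omega), if_neg (by omega)]

theorem piK_desc_apply {k d : ℕ} (h : k + d ≤ n - 1) (a : Fin n) (ha : a.val = k) :
    (piK n c (desc n c k d) a).val = k + d := by
  induction d with
  | zero => simpa [desc] using ha
  | succ d ih =>
    rw [desc, map_mul, Equiv.Perm.mul_apply, piK_rhoNat_apply_val (by omega), ih (by omega),
      if_pos rfl, add_assoc]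

/-- The descending word sends k to k + d while the other factor fixes k, so fixing k forces d = 0.
-/
theorem mem_rhoSubgroup_succ {k : ℕ} {x : UV n c} (hx : x ∈ rhoSubgroup n c k) (a : Fin n)
    (ha : a.val = k) (hxa : piK n c x a = a) : x ∈ rhoSubgroup n c (k + 1) := by
  obtain ⟨d, y, hd, hy, rfl⟩ := exists_desc_mul (by omega) hx
  rw [map_mul, Equiv.Perm.mul_apply, piK_apply_of_lt hy (by omega), Fin.ext_iff,
    piK_desc_apply hd a ha] at hxa
  obtain rfl : d = 0 := by omega
  rwa [desc, one_mul]

theorem eq_one_of_piK_eq_one {x : UV n c} (hx : x ∈ rhoSubgroup n c 0) (h : piK n c x = 1) :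
    x = 1 := by
  have key : ∀ k, k ≤ n - 1 → x ∈ rhoSubgroup n c k := by
    intro k
    induction k with
    | zero => exact fun _ => hx
    | succ k ih =>
      exact fun hk => mem_rhoSubgroup_succ (ih (by omega)) ⟨k, by omega⟩ rfl (by rw [h]; rfl)
  have h1 := key (n - 1) le_rfl
  have : {x | ∃ i, n - 1 ≤ i ∧ i < n - 1 ∧ x = rhoNat n c i} = ∅ := by
    ext y
    simp only [Set.mem_ofPred_eq, Set.mem_empty_iff_false, iff_false]
    rintro ⟨i, h₁, h₂, -⟩
    omega
  rwa [rhoSubgroup, this, Subgroup.closure_empty, Subgroup.mem_bot] at h1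

theorem exists_mem_rhoSubgroup_piK (g : Equiv.Perm (Fin n)) :
    ∃ x ∈ rhoSubgroup n c 0, piK n c x = g := by
  rcases n with _ | m
  · exact ⟨1, Subgroup.one_mem _, Subsingleton.elim _ _⟩
  · suffices (⊤ : Submonoid (Equiv.Perm (Fin (m + 1)))) ≤
        ((rhoSubgroup (m + 1) c 0).map (piK (m + 1) c)).toSubmonoid from
      this (Submonoid.mem_top g)
    rw [← Equiv.Perm.mclosure_swap_castSucc_succ, Submonoid.closure_le]
    rintro _ ⟨i, rfl⟩
    exact ⟨rho c i, rho_mem (n := m + 1) i, piK_rho (n := m + 1) i⟩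

/-! ### The elements δ as conjugates of σ_{0,t} -/

theorem conj_sigmaNat_zero_eq (hn : 2 ≤ n) (t : Fin c) {x y : UV n c}
    (hx : x ∈ rhoSubgroup n c 0) (hy : y ∈ rhoSubgroup n c 0)
    (h₀ : piK n c x ⟨0, by omega⟩ = piK n c y ⟨0, by omega⟩)
    (h₁ : piK n c x ⟨1, by omega⟩ = piK n c y ⟨1, by omega⟩) :
    x * sigmaNat n t 0 * x⁻¹ = y * sigmaNat n t 0 * y⁻¹ := by
  have hz : y⁻¹ * x ∈ rhoSubgroup n c 2 := by
    refine mem_rhoSubgroup_succ (mem_rhoSubgroup_succ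
      (Subgroup.mul_mem _ (Subgroup.inv_mem _ hy) hx) ⟨0, by omega⟩ rfl ?_) ⟨1, by omega⟩ rfl ?_
    · rw [map_mul, Equiv.Perm.mul_apply, h₀, map_inv]
      exact Equiv.symm_apply_apply _ _
    · rw [map_mul, Equiv.Perm.mul_apply, h₁, map_inv]
      exact Equiv.symm_apply_apply _ _
  have hcomm : rhoSubgroup n c 2 ≤ Subgroup.centralizer {sigmaNat n t 0} := by
    rw [rhoSubgroup, Subgroup.closure_le]
    rintro _ ⟨i, h₁, h₂, rfl⟩
    rw [SetLike.mem_coe, Subgroup.mem_centralizer_singleton_iff, rhoNat_of_lt h₂,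
      sigmaNat_of_lt t (by omega)]
    exact (commute_sigma_rho t (Or.inl (by simpa using h₁))).eq.symm
  have := Subgroup.mem_centralizer_singleton_iff.1 (hcomm hz)
  calc x * sigmaNat n t 0 * x⁻¹ = y * (y⁻¹ * x * sigmaNat n t 0) * x⁻¹ := by group
    _ = y * sigmaNat n t 0 * y⁻¹ := by rw [this]; group

/-- The mixed relation makes σ_{i+1,t} the conjugate of σ_{i,t} by ρ_i ρ_{i+1}. -/
theorem exists_conj_sigmaNat_zero (hn : 2 ≤ n) (t : Fin c) {i : ℕ} (hi : i < n - 1) :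
    ∃ x ∈ rhoSubgroup n c 0, sigmaNat n t i = x * sigmaNat n t 0 * x⁻¹ ∧
      (piK n c x ⟨0, by omega⟩).val = i ∧ (piK n c x ⟨1, by omega⟩).val = i + 1 := by
  induction i with
  | zero => exact ⟨1, Subgroup.one_mem _, by simp⟩
  | succ i ih =>
    obtain ⟨x, hx, hs, h₀, h₁⟩ := ih (by omega)
    refine ⟨rhoNat n c i * rhoNat n c (i + 1) * x, Subgroup.mul_mem _ (Subgroup.mul_mem _
      (rhoNat_mem (by omega) (by omega)) (rhoNat_mem (by omega) hi)) hx, ?_, ?_, ?_⟩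
    · have h := rho_rho_sigma (i := ⟨i, by omega⟩) (j := ⟨i + 1, hi⟩) t rfl
      rw [← rhoNat_of_lt, ← rhoNat_of_lt, ← sigmaNat_of_lt, ← sigmaNat_of_lt] at h
      calc sigmaNat n t (i + 1) = rhoNat n c i * rhoNat n c (i + 1) * sigmaNat n t i *
            (rhoNat n c i * rhoNat n c (i + 1))⁻¹ := by rw [h]; group
        _ = _ := by rw [hs]; group
    · rw [map_mul, map_mul, Equiv.Perm.mul_apply, Equiv.Perm.mul_apply,
        piK_rhoNat_apply_val (by omega), piK_rhoNat_apply_val hi, h₀]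
      split_ifs <;> omega
    · rw [map_mul, map_mul, Equiv.Perm.mul_apply, Equiv.Perm.mul_apply,
        piK_rhoNat_apply_val (by omega), piK_rhoNat_apply_val hi, h₁]
      split_ifs <;> omega

theorem rhoDesc_eq_desc {i d : ℕ} (h : i + d < n - 1) : rhoDesc c i d h = desc n c (i + 1) d := by
  induction d with
  | zero => rfl
  | succ d ih =>
    rw [rhoDesc, desc, ih, show i + 1 + d = i + (d + 1) by ring, rhoNat_of_lt h]

theorem exists_delta_eq (hn : 2 ≤ n) (v : KUVVertex n c) :
    ∃ x ∈ rhoSubgroup n c 0, delta v = x * sigmaNat n v.t 0 * x⁻¹ ∧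
      piK n c x ⟨0, by omega⟩ = v.i ∧ piK n c x ⟨1, by omega⟩ = v.j := by
  have hv := v.ne
  have hi := v.i.2
  have hj := v.j.2
  rw [Ne, Fin.ext_iff] at hv
  by_cases h : v.i < v.j
  · have h' : v.i.val < v.j.val := h
    obtain ⟨x, hx, hs, h₀, h₁⟩ :=
      exists_conj_sigmaNat_zero hn v.t (i := v.i.val) (by omega)
    have hd : v.i.val + 1 + (v.j.val - v.i.val - 1) ≤ n - 1 := by omega
    have hm := desc_mem (c := c) hd
    refine ⟨desc n c (v.i.val + 1) (v.j.val - v.i.val - 1) * x,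
      Subgroup.mul_mem _ (rhoSubgroup_anti (Nat.zero_le _) hm) hx, ?_, ?_, ?_⟩
    · simp only [delta, h, dif_pos, rhoDesc_eq_desc]
      rw [← sigmaNat_of_lt, hs]
      group
    · rw [map_mul, Equiv.Perm.mul_apply, Fin.ext h₀, piK_apply_of_lt hm (by omega)]
    · ext
      rw [map_mul, Equiv.Perm.mul_apply, piK_desc_apply hd _ h₁]
      omega
  · have h' : v.j.val < v.i.val := by
      rw [Fin.lt_def] at h
      omega
    obtain ⟨x, hx, hs, h₀, h₁⟩ :=
      exists_conj_sigmaNat_zero hn v.t (i := v.j.val) (by omega)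
    have hd : v.j.val + 1 + (v.i.val - v.j.val - 1) ≤ n - 1 := by omega
    have hm := desc_mem (c := c) hd
    refine ⟨desc n c (v.j.val + 1) (v.i.val - v.j.val - 1) * rhoNat n c v.j.val * x,
      Subgroup.mul_mem _ (Subgroup.mul_mem _ (rhoSubgroup_anti (Nat.zero_le _) hm)
        (rhoNat_mem (by omega) (by omega))) hx, ?_, ?_, ?_⟩
    · simp only [delta, h, dif_neg, not_false_eq_true, rhoDesc_eq_desc]
      rw [← sigmaNat_of_lt, ← rhoNat_of_lt, hs]
      -- As ρ_j is an involution, the right-hand ρ_j is read as an inverse, exhibiting a conjugate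
      -- by wρ_j.
      nth_rewrite 2 [← rhoNat_inv]
      simp only [mul_inv_rev, mul_assoc]
    · ext
      rw [map_mul, map_mul, Equiv.Perm.mul_apply, Equiv.Perm.mul_apply, piK_desc_apply hd]
      · omega
      · rw [piK_rhoNat_apply_val (by omega), if_pos h₀]
    · have h2 : piK n c (rhoNat n c v.j.val) (piK n c x ⟨1, by omega⟩) = v.j := by
        ext
        rw [piK_rhoNat_apply_val (by omega), if_neg (by omega), if_pos h₁]
      rw [map_mul, map_mul, Equiv.Perm.mul_apply, Equiv.Perm.mul_apply, h2,
        piK_apply_of_lt hm (by omega)]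

theorem delta_eq_conj (hn : 2 ≤ n) (v : KUVVertex n c) {x : UV n c} (hx : x ∈ rhoSubgroup n c 0)
    (h₀ : piK n c x ⟨0, by omega⟩ = v.i) (h₁ : piK n c x ⟨1, by omega⟩ = v.j) :
    delta v = x * sigmaNat n v.t 0 * x⁻¹ := by
  obtain ⟨y, hy, hd, hy₀, hy₁⟩ := exists_delta_eq hn v
  rw [hd]
  exact conj_sigmaNat_zero_eq hn v.t hy hx (hy₀.trans h₀.symm) (hy₁.trans h₁.symm)

end UV

/-! ### `KUV_n(c)` as a right-angled Artin group -/

namespace KUVVertex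

variable {n c : ℕ}

/-- The action of a permutation of the strands on the vertices of `kuvGraph n c`. -/
def perm (g : Equiv.Perm (Fin n)) (v : KUVVertex n c) : KUVVertex n c :=
  ⟨g v.i, g v.j, g.injective.ne v.ne, v.t⟩

theorem perm_adj (g : Equiv.Perm (Fin n)) {v w : KUVVertex n c} (h : (kuvGraph n c).Adj v w) :
    (kuvGraph n c).Adj (perm g v) (perm g w) :=
  ⟨g.injective.ne h.1, g.injective.ne h.2.1, g.injective.ne h.2.2.1, g.injective.ne h.2.2.2⟩

/-- The endomorphism of the right-angled Artin group induced by a permutation of the strands. -/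
def permHom (g : Equiv.Perm (Fin n)) : RAAG (kuvGraph n c) →* RAAG (kuvGraph n c) :=
  RAAG.lift (fun v => RAAG.of _ (perm g v)) fun _ _ h => RAAG.commute_of (perm_adj g h)

@[simp]
theorem permHom_of (g : Equiv.Perm (Fin n)) (v : KUVVertex n c) :
    permHom g (RAAG.of _ v) = RAAG.of _ (perm g v) := RAAG.lift_of _ _ v

theorem permHom_comp (g h : Equiv.Perm (Fin n)) :
    (permHom g).comp (permHom h) = permHom (c := c) (g * h) :=
  RAAG.hom_ext fun v => by rw [MonoidHom.comp_apply]; simp only [permHom_of]; rfl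

theorem permHom_one : permHom 1 = MonoidHom.id (RAAG (kuvGraph n c)) :=
  RAAG.hom_ext fun v => permHom_of 1 v

/-- The action of the permutations of the strands on the right-angled Artin group. -/
def permAut (n c : ℕ) : Equiv.Perm (Fin n) →* MulAut (RAAG (kuvGraph n c)) where
  toFun g := MonoidHom.toMulEquiv (permHom g) (permHom g⁻¹)
    (by rw [permHom_comp, inv_mul_cancel, permHom_one])
    (by rw [permHom_comp, mul_inv_cancel, permHom_one])
  map_one' := MulEquiv.ext fun x => DFunLike.congr_fun permHom_one x
  map_mul' g h := MulEquiv.ext fun x => (DFunLike.congr_fun (permHom_comp g h) x).symm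

theorem permAut_of (g : Equiv.Perm (Fin n)) (v : KUVVertex n c) :
    permAut n c g (RAAG.of _ v) = RAAG.of _ (perm g v) := permHom_of g v

end KUVVertex

/-! ### The splitting of `UV n c` -/

namespace UV

variable {n c : ℕ}

/-- The vertex `(i, i + 1, t)`. -/
def adjVertex (i : Fin (n - 1)) (t : Fin c) : KUVVertex n c :=
  ⟨⟨i.val, by omega⟩, ⟨i.val + 1, by omega⟩, by simp, t⟩

/-- The assignment `σ_{i,t} ↦ (i, i + 1, t)`, `ρ_i ↦ s_i`. -/
def genSemidirect : UVGen n c → RAAG (kuvGraph n c) ⋊[KUVVertex.permAut n c] Equiv.Perm (Fin n)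
  | .sigma i t => SemidirectProduct.inl (RAAG.of _ (adjVertex i t))
  | .rho i => SemidirectProduct.inr (adjSwap i)

theorem inr_mul_inl_of (g : Equiv.Perm (Fin n)) (v : KUVVertex n c) :
    (SemidirectProduct.inr g * SemidirectProduct.inl (RAAG.of _ v) :
      RAAG (kuvGraph n c) ⋊[KUVVertex.permAut n c] Equiv.Perm (Fin n)) =
      SemidirectProduct.inl (RAAG.of _ (KUVVertex.perm g v)) * SemidirectProduct.inr g := by
  rw [← KUVVertex.permAut_of, SemidirectProduct.inl_aut, map_inv, inv_mul_cancel_right]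

theorem genSemidirect_rel (n c : ℕ) :
    ∀ r ∈ {r | UVRel n c r}, FreeGroup.lift (genSemidirect (n := n) (c := c)) r = 1 := by
  rintro r (h : UVRel n c r)
  cases h <;> simp only [UVGen.R, UVGen.S, map_mul, map_inv, FreeGroup.lift_apply_of,
    genSemidirect, mul_inv_eq_one]
  case pr1 i j h => rw [← map_mul, ← map_mul, adjSwap_braid i j h, map_mul, map_mul]
  case pr2 i j h => rw [← map_mul, adjSwap_comm i j h, map_mul]
  case pr3 i => rw [← map_mul, adjSwap_mul_self, map_one]
  case cr i j t l h =>
    rw [← map_mul, ← map_mul, (RAAG.commute_of _).eq]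
    refine ⟨?_, ?_, ?_, ?_⟩ <;> rw [Ne, Fin.ext_iff] <;> simp only [adjVertex] <;>
      rcases h with h | h <;> omega
  case mr1 i j t h =>
    rw [inr_mul_inl_of]
    congr 4
    ext <;> simp only [KUVVertex.perm, adjVertex, adjSwap_apply_val] <;>
      rcases h with h | h <;> split_ifs <;> omega
  case mr2 i j t h =>
    rw [← map_mul, inr_mul_inl_of, map_mul, ← mul_assoc]
    congr 4
    ext <;> simp only [KUVVertex.perm, adjVertex, Equiv.Perm.mul_apply, adjSwap_apply_val] <;>
      split_ifs <;> omega

/-- The homomorphism from `UV_n(c)` to the semidirect product of the right-angled Artin group and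
the symmetric group. -/
def toSemidirect (n c : ℕ) :
    UV n c →* RAAG (kuvGraph n c) ⋊[KUVVertex.permAut n c] Equiv.Perm (Fin n) :=
  PresentedGroup.toGroup (genSemidirect_rel n c)

theorem toSemidirect_sigma (i : Fin (n - 1)) (t : Fin c) :
    toSemidirect n c (sigma i t) = SemidirectProduct.inl (RAAG.of _ (adjVertex i t)) :=
  PresentedGroup.toGroup.of _

theorem toSemidirect_rho (i : Fin (n - 1)) :
    toSemidirect n c (rho c i) = SemidirectProduct.inr (adjSwap i) :=
  PresentedGroup.toGroup.of _

theorem toSemidirect_eq_inr {x : UV n c} (hx : x ∈ rhoSubgroup n c 0) :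
    toSemidirect n c x = SemidirectProduct.inr (piK n c x) := by
  suffices rhoSubgroup n c 0 ≤
    (toSemidirect n c).eqLocus (SemidirectProduct.inr.comp (piK n c)) from this hx
  rw [rhoSubgroup, Subgroup.closure_le]
  rintro _ ⟨i, -, h, rfl⟩
  change toSemidirect n c (rhoNat n c i) = SemidirectProduct.inr (piK n c (rhoNat n c i))
  rw [rhoNat_of_lt h, toSemidirect_rho, piK_rho]

theorem toSemidirect_delta (hn : 2 ≤ n) (v : KUVVertex n c) :
    toSemidirect n c (delta v) = SemidirectProduct.inl (RAAG.of _ v) := by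
  obtain ⟨x, hx, hd, h₀, h₁⟩ := exists_delta_eq hn v
  rw [hd, map_mul, map_mul, map_inv, toSemidirect_eq_inr hx, sigmaNat_of_lt v.t (by omega),
    toSemidirect_sigma, inr_mul_inl_of, mul_inv_cancel_right]
  congr 2
  ext
  · exact congrArg Fin.val h₀
  · exact congrArg Fin.val h₁
  · rfl

/-- Four distinct strands are the images of 0, 1, 2, 3 under one permutation, so both elements are
simultaneous conjugates of σ_0 and σ_2, which commute. -/
theorem commute_delta (hn : 2 ≤ n) {v w : KUVVertex n c} (h : (kuvGraph n c).Adj v w) :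
    Commute (delta v) (delta w) := by
  let p : Fin 4 → Fin n := ![v.i, v.j, w.i, w.j]
  have hp : Function.Injective p := by
    obtain ⟨h1, h2, h3, h4⟩ := h
    have hv := v.ne
    have hw := w.ne
    intro a b hab
    fin_cases a <;> fin_cases b <;> simp_all [p]
  have hn4 : 4 ≤ n := by simpa using Fintype.card_le_of_injective p hp
  obtain ⟨g, hg⟩ := Equiv.Perm.exists_extending_pair _ _ (Fin.castLE_injective hn4) hp
  obtain ⟨x, hx, rfl⟩ := exists_mem_rhoSubgroup_piK (c := c) g
  obtain ⟨y, hy, hs, h₀, h₁⟩ := exists_conj_sigmaNat_zero hn w.t (i := 2) (by omega)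
  have hw : delta w = x * sigmaNat n w.t 2 * x⁻¹ := by
    rw [hs, delta_eq_conj hn w (Subgroup.mul_mem _ hx hy)]
    · group
    · rw [map_mul, Equiv.Perm.mul_apply]
      exact (congrArg _ (Fin.ext h₀)).trans (hg 2)
    · rw [map_mul, Equiv.Perm.mul_apply]
      exact (congrArg _ (Fin.ext h₁)).trans (hg 3)
  rw [hw, delta_eq_conj hn v hx (hg 0) (hg 1), sigmaNat_of_lt v.t (by omega),
    sigmaNat_of_lt w.t (by omega)]
  exact (commute_sigma _ _ (Or.inl (by simp))).conj x

/-- The homomorphism from the right-angled Artin group to `UV_n(c)` with `v ↦ δ_v`. -/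
def deltaHom (c : ℕ) (hn : 2 ≤ n) : RAAG (kuvGraph n c) →* UV n c :=
  RAAG.lift delta fun _ _ h => commute_delta hn h

theorem deltaHom_of (hn : 2 ≤ n) (v : KUVVertex n c) : deltaHom c hn (RAAG.of _ v) = delta v :=
  RAAG.lift_of _ _ v

theorem deltaHom_injective (hn : 2 ≤ n) : Function.Injective (deltaHom c hn) := by
  have h : (toSemidirect n c).comp (deltaHom c hn) = SemidirectProduct.inl :=
    RAAG.hom_ext fun v => by
      rw [MonoidHom.comp_apply, deltaHom_of, toSemidirect_delta hn]
  apply Function.Injective.of_comp (f := toSemidirect n c)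
  rw [← MonoidHom.coe_comp, h]
  exact SemidirectProduct.inl_injective

theorem rho_mul_deltaHom (hn : 2 ≤ n) (i : Fin (n - 1)) (a : RAAG (kuvGraph n c)) :
    rho c i * deltaHom c hn a = deltaHom c hn (KUVVertex.permHom (adjSwap i) a) * rho c i := by
  have h : (MulAut.conj (rho c i)).toMonoidHom.comp (deltaHom c hn) =
      (deltaHom c hn).comp (KUVVertex.permHom (adjSwap i)) := RAAG.hom_ext fun v => by
    obtain ⟨x, hx, hd, h₀, h₁⟩ := exists_delta_eq hn v
    rw [MonoidHom.comp_apply, MonoidHom.comp_apply, KUVVertex.permHom_of, deltaHom_of,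
      deltaHom_of, delta_eq_conj hn (KUVVertex.perm (adjSwap i) v)
      (Subgroup.mul_mem _ (rho_mem i) hx), hd]
    · simp [KUVVertex.perm, mul_assoc]
    · rw [map_mul, Equiv.Perm.mul_apply, h₀, piK_rho]
      rfl
    · rw [map_mul, Equiv.Perm.mul_apply, h₁, piK_rho]
      rfl
  rw [← mul_inv_eq_iff_eq_mul]
  exact DFunLike.congr_fun h a

theorem delta_adjVertex (hn : 2 ≤ n) (i : Fin (n - 1)) (t : Fin c) :
    delta (adjVertex i t) = sigma i t := by
  obtain ⟨x, hx, hs, h₀, h₁⟩ := exists_conj_sigmaNat_zero hn t i.2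
  rw [delta_eq_conj hn (adjVertex i t) hx (Fin.ext h₀) (Fin.ext h₁), ← sigmaNat_of_lt t i.2, hs]
  rfl

/-- Such products are stable under left multiplication by generators: σ_{i,t} is itself a δ, and ρ_i
normalises the image of `deltaHom`. -/
theorem exists_deltaHom_mul (hn : 2 ≤ n) (x : UV n c) :
    ∃ a, ∃ y ∈ rhoSubgroup n c 0, x = deltaHom c hn a * y := by
  have hgen : Subgroup.closure (Set.range PresentedGroup.of) = (⊤ : Subgroup (UV n c)) :=
    PresentedGroup.closure_range_of _
  have step_rho : ∀ (i : Fin (n - 1)) (x : UV n c),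
      (∃ a, ∃ y ∈ rhoSubgroup n c 0, x = deltaHom c hn a * y) →
      ∃ a, ∃ y ∈ rhoSubgroup n c 0, rho c i * x = deltaHom c hn a * y := by
    rintro i _ ⟨a, y, hy, rfl⟩
    exact ⟨_, _, Subgroup.mul_mem _ (rho_mem i) hy, by
      rw [← mul_assoc, rho_mul_deltaHom, mul_assoc]⟩
  have hx : x ∈ Subgroup.closure (Set.range PresentedGroup.of) := hgen ▸ Subgroup.mem_top x
  induction hx using Subgroup.closure_induction_left with
  | one => exact ⟨1, 1, Subgroup.one_mem _, by simp⟩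
  | mul_left x hx y _ ih =>
    obtain ⟨_ | i, rfl⟩ := hx
    · rename_i i t
      obtain ⟨a, y, hy, rfl⟩ := ih
      refine ⟨RAAG.of _ (adjVertex i t) * a, y, hy, ?_⟩
      rw [map_mul, deltaHom_of, delta_adjVertex hn, mul_assoc]
      rfl
    · exact step_rho i _ ih
  | inv_mul_cancel x hx y _ ih =>
    obtain ⟨_ | i, rfl⟩ := hx
    · rename_i i t
      obtain ⟨a, y, hy, rfl⟩ := ih
      refine ⟨(RAAG.of _ (adjVertex i t))⁻¹ * a, y, hy, ?_⟩
      rw [map_mul, map_inv, deltaHom_of, delta_adjVertex hn, mul_assoc]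
      rfl
    · change ∃ a, ∃ z ∈ rhoSubgroup n c 0, (rho c i)⁻¹ * y = deltaHom c hn a * z
      rw [rho_inv]
      exact step_rho i _ ih

theorem piK_delta (hn : 2 ≤ n) (v : KUVVertex n c) : piK n c (delta v) = 1 := by
  obtain ⟨x, hx, hd, -, -⟩ := exists_delta_eq hn v
  rw [hd, sigmaNat_of_lt v.t (by omega), map_mul, map_mul, piK_sigma, mul_one, map_inv,
    mul_inv_cancel]

theorem range_deltaHom (hn : 2 ≤ n) : (deltaHom c hn).range = KUV n c := by
  have hle : ∀ a, piK n c (deltaHom c hn a) = 1 := by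
    have h : (piK n c).comp (deltaHom c hn) = 1 := RAAG.hom_ext fun v => by
      rw [MonoidHom.comp_apply, deltaHom_of, piK_delta hn]
      rfl
    exact fun a => DFunLike.congr_fun h a
  apply le_antisymm
  · rintro _ ⟨a, rfl⟩
    exact hle a
  · intro x hx
    obtain ⟨a, y, hy, rfl⟩ := exists_deltaHom_mul hn x
    have hx' : piK n c (deltaHom c hn a * y) = 1 := hx
    rw [map_mul, hle, one_mul] at hx'
    rw [eq_one_of_piK_eq_one hy hx', mul_one]
    exact ⟨a, rfl⟩

/-- The isomorphism from the right-angled Artin group onto `KUV_n(c)` with `v ↦ δ_v`. -/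
noncomputable def deltaEquiv (c : ℕ) (hn : 2 ≤ n) : RAAG (kuvGraph n c) ≃* KUV n c :=
  ((deltaHom c hn).ofInjective (deltaHom_injective hn)).trans
    (MulEquiv.subgroupCongr (range_deltaHom hn))

/-- Under `piP` each δ becomes a conjugate of a transposition, so its square dies. -/
theorem delta_sq_mem_PUV (hn : 2 ≤ n) (v : KUVVertex n c) : delta v ^ 2 ∈ PUV n c := by
  obtain ⟨x, -, hd, -, -⟩ := exists_delta_eq hn v
  have h : piP n c (sigmaNat n v.t 0) = adjSwap ⟨0, by omega⟩ := by
    rw [sigmaNat_of_lt v.t (by omega)]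
    exact PresentedGroup.toGroup.of _
  change piP n c (delta v ^ 2) = 1
  rw [hd, conj_pow, map_mul, map_mul, map_pow, h, pow_two, adjSwap_mul_self, mul_one, map_inv,
    mul_inv_cancel]

/-! ### The Howson property for `UV_n(c)` and its subgroups -/

instance : Finite (KUVVertex n c) :=
  Finite.of_injective (fun v : KUVVertex n c => (v.i, v.j, v.t)) fun v w h => by
    simp only [Prod.mk.injEq] at h
    exact KUVVertex.ext h.1 h.2.1 h.2.2

theorem isHowson_of_le_three (hn : 2 ≤ n) (h3 : n ≤ 3) : IsHowson (UV n c) := by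
  have hadj : ∀ v w : KUVVertex n c, ¬ (kuvGraph n c).Adj v w := by
    rintro v w ⟨h1, h2, h4, h5⟩
    have hv := v.ne
    have hw := w.ne
    rw [Ne, Fin.ext_iff] at *
    omega
  let f : RAAG (kuvGraph n c) →* FreeGroup (KUVVertex n c) :=
    RAAG.lift FreeGroup.of fun v w h => (hadj v w h).elim
  let g : FreeGroup (KUVVertex n c) →* RAAG (kuvGraph n c) := FreeGroup.lift (RAAG.of _)
  have hgf : g.comp f = MonoidHom.id _ := RAAG.hom_ext fun v => by simp [f, g]
  have hf : Function.Injective f :=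
    Function.LeftInverse.injective (g := g) fun x => DFunLike.congr_fun hgf x
  have hK : IsHowson (KUV n c) :=
    (FreeGroup.isHowson.of_injective f hf).of_injective (deltaEquiv c hn).symm.toMonoidHom
      (deltaEquiv c hn).symm.injective
  have : (KUV n c).FiniteIndex := inferInstanceAs (piK n c).ker.FiniteIndex
  exact IsHowson.of_finiteIndex (KUV n c) hK

theorem exists_isInducedPathTwo (hc : 1 ≤ c) (h : 4 ≤ n) :
    ∃ v₁ v₂ v₃ : KUVVertex n c, IsInducedPathTwo (kuvGraph n c) v₁ v₂ v₃ := by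
  -- The end vertices use the same two strands in opposite orders; the middle one uses two other
  -- strands.
  refine ⟨⟨⟨0, by omega⟩, ⟨1, by omega⟩, by simp, ⟨0, hc⟩⟩,
    ⟨⟨2, by omega⟩, ⟨3, by omega⟩, by simp, ⟨0, hc⟩⟩,
    ⟨⟨1, by omega⟩, ⟨0, by omega⟩, by simp, ⟨0, hc⟩⟩, ?_⟩
  simp [IsInducedPathTwo, kuvGraph]

theorem not_isHowson_of_delta_pow_mem (hn : 2 ≤ n) {v₁ v₂ v₃ : KUVVertex n c}
    (h : IsInducedPathTwo (kuvGraph n c) v₁ v₂ v₃) {m : ℕ} (hm : m ≠ 0) {K : Subgroup (UV n c)}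
    (h₁ : delta v₁ ^ m ∈ K) (h₂ : delta v₂ ^ m ∈ K) (h₃ : delta v₃ ^ m ∈ K) : ¬ IsHowson K := by
  intro hK
  have key : ∀ {v}, delta v ^ m ∈ K → RAAG.of _ v ^ m ∈ K.comap (deltaHom c hn) := fun {v} hv => by
    rwa [Subgroup.mem_comap, map_pow, deltaHom_of]
  refine RAAG.not_isHowson_of_pow_mem h hm (key h₁) (key h₂) (key h₃)
    (hK.of_injective ((deltaHom c hn).subgroupComap K) ?_)
  intro x y hxy
  exact Subtype.ext (deltaHom_injective hn (congrArg Subtype.val hxy))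

end UV

theorem mainTheorem5 (n c : ℕ) (hn : 2 ≤ n) (hc : 1 ≤ c) :
    (IsHowson (UV n c) ↔ n ≤ 3) ∧
    (IsHowson (PUV n c) ↔ n ≤ 3) ∧
    (∃ φ : RAAG (kuvGraph n c) ≃* KUV n c,
      ∀ v : KUVVertex n c, (φ (RAAG.of (kuvGraph n c) v) : UV n c) = delta v) ∧
    (4 ≤ n →
      (∃ v₁ v₂ v₃ : KUVVertex n c, IsInducedPathTwo (kuvGraph n c) v₁ v₂ v₃) ∧
      (∀ v₁ v₂ v₃ : KUVVertex n c, IsInducedPathTwo (kuvGraph n c) v₁ v₂ v₃ →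
        ¬ IsHowson (Subgroup.closure ({delta v₁, delta v₂, delta v₃} : Set (UV n c)))) ∧
      ¬ IsHowson (KUV n c)) := by
  -- The case of `PUV n c` also settles `UV n c`, because the Howson property passes to subgroups.
  have hPUV : IsHowson (PUV n c) → n ≤ 3 := by
    intro hP
    by_contra! h
    obtain ⟨v₁, v₂, v₃, hv⟩ := UV.exists_isInducedPathTwo hc h
    exact UV.not_isHowson_of_delta_pow_mem hn hv two_ne_zero (UV.delta_sq_mem_PUV hn v₁)
      (UV.delta_sq_mem_PUV hn v₂) (UV.delta_sq_mem_PUV hn v₃) hP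
  have hsub : IsHowson (UV n c) → ∀ K : Subgroup (UV n c), IsHowson K := fun h K =>
    h.of_injective K.subtype K.subtype_injective
  refine ⟨⟨fun h => hPUV (hsub h _), UV.isHowson_of_le_three hn⟩,
    ⟨hPUV, fun h => hsub (UV.isHowson_of_le_three hn h) _⟩,
    ⟨UV.deltaEquiv c hn, fun v => UV.deltaHom_of hn v⟩, fun h4 =>
    ⟨UV.exists_isInducedPathTwo hc h4, fun v₁ v₂ v₃ hv => ?_, fun hK => ?_⟩⟩
  · refine UV.not_isHowson_of_delta_pow_mem hn hv one_ne_zero ?_ ?_ ?_ <;>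
      rw [pow_one] <;> exact Subgroup.subset_closure (by simp)
  · obtain ⟨v₁, v₂, v₃, hv⟩ := UV.exists_isInducedPathTwo hc h4
    refine UV.not_isHowson_of_delta_pow_mem hn hv one_ne_zero ?_ ?_ ?_ hK <;>
      rw [pow_one] <;> exact UV.piK_delta hn _
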